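/- Let $G=(\mathcal V,\mathcal A)$ be a finite directed graph, $\mathcal A_1\subseteq\mathcal A$ the set of tolled arcs, $n=|\mathcal A_1|$, and $c\in\mathbb R^{\mathcal A}$ a cost vector with $c_a\ge 0$ for every toll-free arc $a\in\mathcal A\setminus\mathcal A_1$. Let $\mathcal K$ be a finite nonempty set of commodities; each $k\in\mathcal K$ has an origin $o^k$ and a destination $d^k\neq o^k$ such that some path from $o^k$ to $d^k$ uses toll-free arcs only. Let $A$ be the node-arc incidence matrix of $G$ and $b^k$ the vector with $b^k_{o^k}=1$, $b^k_{d^k}=-1$ and $b^k_i=0$ for all other nodes. For $x\in\mathbb R^{\mathcal A}$ let $x_{\mathcal A_1}$ be its restriction to the tolled arcs. For $t\in\mathbb R^n$ define the (extended real) optimal values $$f^k(t)=\inf\{c^{\mathsf T}x+t^{\mathsf T}w \mid x_{\mathcal A_1}\le w,\ Ax=b^k,\ w\ge 0,\ x\ge 0\},$$ $$f(t)=\inf\Bigl\{\sum_{k\in\mathcal K}c^{\mathsf T}x^k+t^{\mathsf T}w \;\Big|\; \sum_{k\in\mathcal K}x^k_{\mathcal A_1}\le w,\ Ax^k=b^k,\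 w\ge 0,\ x^k\ge 0\ (k\in\mathcal K)\Bigr\},$$ (both are $-\infty$ unless $t\ge0$), and for $w\in\mathbb R^n$ put $$g^k(w)=\sup_{t}\{f^k(t)-t^{\mathsf T}w\},\qquad g(w)=\sup_{t}\{f(t)-t^{\mathsf T}w\}.$$ For $h\in\{g,g^k\}$, with epigraph $\operatorname{epi}(h)=\{(w,z)\in\mathbb R^n\times\mathbb R\mid z\ge h(w)\}$, a set $W\subseteq\mathbb R^n$ is a reaction set of $h$ if it is the projection to the $w$-space of a nonempty face $F$ of $\operatorname{epi}(h)$ that is non-vertical, meaning that the vector $(0,1)$ is not in the linear subspace parallel to the affine hull of $F$. A vector $w$ is strongly bilevel feasible (with respect to $g$) if $\{w\}$ is a reaction set of $g$; a vector $w^k$ is strongly bilevel feasible individually, for commodity $k$, if $\{w^k\}$ is a reaction set of $g^k$. A bilevel feasible decomposition of $w$ is a tuple $(w^k)_{k\in\mathcal K}$ of vectors of $\mathbb R^n$ with $w=\sum_{k}w^k$ and $g\bigl(\sum_k w^k\bigr)=\sum_k g^k(w^k)$. Proposition. Let $w\in\mathbb R^n$, $w\ge 0$. Then $w$ is strongly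 bilevel feasible if and only if for every bilevel feasible decomposition $(w^k)$ of $w$ and every $k\in\mathcal K$, the vector $w^k$ is strongly bilevel feasible individually. -/

import Mathlib

open scoped Matrix

noncomputable section

/-! ### Conjugates, epigraphs and reaction sets -/

/-- `g(w) = sup_t { f(t) - tᵀ w }`, the convex conjugate of `t ↦ -f(-t)`. -/
def conjugateOf {ι : Type*} [Fintype ι] (f : (ι → ℝ) → EReal) (w : ι → ℝ) : EReal :=
  ⨆ t : ι → ℝ, (f t - ((t ⬝ᵥ w : ℝ) : EReal))

/-- The epigraph of an extended real valued function, as a subset of `ℝⁿ × ℝ`. -/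
def epigraphOf {ι : Type*} (g : (ι → ℝ) → EReal) : Set ((ι → ℝ) × ℝ) :=
  {p | g p.1 ≤ (p.2 : EReal)}

/-- Nonempty faces of a convex set `C`: nonempty convex subsets `F` of `C` such that a segment
in `C` with an inner point in `F` has both end points in `F`. -/
def IsFaceOf {E : Type*} [AddCommGroup E] [Module ℝ E] (C F : Set E) : Prop :=
  F.Nonempty ∧ Convex ℝ F ∧ IsExtreme ℝ C F

/-- `W` is a reaction set of `g`: the projection to `w`-space of a face `F` of `epi g` that is
non-vertical, i.e. the direction `(0, 1)` does not belong to the affine hull of `F`. -/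
def IsReactionSet {ι : Type*} (g : (ι → ℝ) → EReal) (W : Set (ι → ℝ)) : Prop :=
  ∃ F : Set ((ι → ℝ) × ℝ), IsFaceOf (epigraphOf g) F ∧
    ((0, 1) : (ι → ℝ) × ℝ) ∉ (affineSpan ℝ F).direction ∧
    W = {w | ∃ z : ℝ, (w, z) ∈ F}

/-- `w` is strongly bilevel feasible (with respect to `g`) when `{w}` is a reaction set. -/
def IsStronglyBilevelFeasible {ι : Type*} (g : (ι → ℝ) → EReal) (w : ι → ℝ) : Prop :=
  IsReactionSet g {w}

/-! ### The network pricing problem -/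

/-- An instance of the network pricing problem: a directed graph with nodes `V` and arcs `A`,
a set of tolled arcs, base costs (nonnegative on the toll-free arcs), and for each commodity
`k : K` an origin and a different destination joined by a toll-free path. -/
structure PricingNetwork (V A K : Type*) where
  src : A → V
  tgt : A → V
  tolled : Finset A
  cost : A → ℝ
  origin : K → V
  dest : K → V
  cost_nonneg : ∀ a, a ∉ tolled → 0 ≤ cost a
  origin_ne_dest : ∀ k, origin k ≠ dest k
  toll_free_path : ∀ k,
    Relation.ReflTransGen (fun u v => ∃ a, a ∉ tolled ∧ src a = u ∧ tgt a = v)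
      (origin k) (dest k)

namespace PricingNetwork

variable {V A K : Type*} [Fintype A] [DecidableEq V]

/-- The node-arc incidence matrix: `+1` at the tail of an arc, `-1` at its head. -/
def incidence (N : PricingNetwork V A K) : Matrix V A ℝ :=
  Matrix.of fun v a => (if N.src a = v then 1 else 0) - (if N.tgt a = v then 1 else 0)

/-- The source-sink vector `bᵏ`. -/
def supply (N : PricingNetwork V A K) (k : K) (v : V) : ℝ :=
  if v = N.origin k then 1 else if v = N.dest k then -1 else 0

/-- The feasible set `{x | A x = bᵏ, x ≥ 0}` of follower `k`. -/
def feasibleSet (N : PricingNetwork V A K) (k : K) : Set (A → ℝ) :=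
  {x | N.incidence *ᵥ x = N.supply k ∧ 0 ≤ x}

/-- The restriction of an arc vector to the tolled arcs. -/
def toTolled (N : PricingNetwork V A K) (x : A → ℝ) : N.tolled → ℝ :=
  fun a => x a

/-- `fᵏ(t)`: the optimal value of
`min { cᵀ x + tᵀ w | x_{A₁} ≤ w, A x = bᵏ, w ≥ 0, x ≥ 0 }`. It is `-∞` when `t ≥ 0` fails,
since `w` can be arbitrarily large. -/
def followerCost (N : PricingNetwork V A K) (k : K) (t : N.tolled → ℝ) : EReal :=
  ⨅ (x : A → ℝ) (w : N.tolled → ℝ)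
    (_ : x ∈ N.feasibleSet k ∧ 0 ≤ w ∧ N.toTolled x ≤ w),
    ((N.cost ⬝ᵥ x + t ⬝ᵥ w : ℝ) : EReal)

/-- `f(t)`: the optimal value of the aggregated problem
`min { ∑ₖ cᵀ xᵏ + tᵀ w | ∑ₖ xᵏ_{A₁} ≤ w, A xᵏ = bᵏ, w ≥ 0, xᵏ ≥ 0 }`. -/
def aggregatedCost [Fintype K] (N : PricingNetwork V A K) (t : N.tolled → ℝ) : EReal :=
  ⨅ (x : K → A → ℝ) (w : N.tolled → ℝ)
    (_ : (∀ k, x k ∈ N.feasibleSet k) ∧ 0 ≤ w ∧ ∑ k, N.toTolled (x k) ≤ w),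
    (((∑ k, N.cost ⬝ᵥ x k) + t ⬝ᵥ w : ℝ) : EReal)

/-- `gᵏ`, the conjugate for commodity `k` alone. -/
def followerBaseCost (N : PricingNetwork V A K) (k : K) : (N.tolled → ℝ) → EReal :=
  conjugateOf (N.followerCost k)

/-- `g`, the conjugate for the aggregated problem. -/
def aggregatedBaseCost [Fintype K] (N : PricingNetwork V A K) : (N.tolled → ℝ) → EReal :=
  conjugateOf N.aggregatedCost

/-- A composition `(wᵏ)` is bilevel feasible when `g(∑ₖ wᵏ) = ∑ₖ gᵏ(wᵏ)`. -/
def IsBilevelFeasibleComposition [Fintype K] (N : PricingNetwork V A K)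
    (ws : K → N.tolled → ℝ) : Prop :=
  N.aggregatedBaseCost (∑ k, ws k) = ∑ k, N.followerBaseCost k (ws k)

/-- A bilevel feasible decomposition of `w`. -/
def IsBilevelFeasibleDecomposition [Fintype K] (N : PricingNetwork V A K)
    (w : N.tolled → ℝ) (ws : K → N.tolled → ℝ) : Prop :=
  w = ∑ k, ws k ∧ N.IsBilevelFeasibleComposition ws

end PricingNetwork

end

/-!
The base cost `g` is the value function of a linear program. By linear programming duality, with
attainment of the primal optimum (`PricingNetwork.aggregatedBaseCost_le_coe_iff`), `g w ≤ z` holds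
exactly when there are flows `xᵏ`, one per commodity, that use at most `w` of the tolled arcs and
cost at most `z`; similarly for each `gᵏ`. Hence `epi g` is the Minkowski sum of the convex sets
`epi gᵏ` (`PricingNetwork.mem_epigraphOf_aggregatedBaseCost_iff`).

A point of a Minkowski sum of convex sets is extreme if and only if, in every way of writing it as
a sum of points of the summands, all these points are extreme (`sum_mem_extremePoints_iff`).
On the other hand `w` is strongly bilevel feasible for `h` exactly when some `(w, z)` is an extreme
point of `epi h`, and then `z = h w` (`isStronglyBilevelFeasible_iff`,
`eq_of_mem_extremePoints_epigraphOf`). Finally, since `g w` is finite for `w ≥ 0` and is the least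
height of a sum of points of the `epi gᵏ` above `w`, the ways of writing `(w, g w)` as such a sum
are exactly the bilevel feasible decompositions of `w`, with every summand on the graph of `gᵏ`.

Duality rests on the Farkas lemma for finitely many linear forms
(`exists_nonneg_combination_of_forall_nonneg`), proved by induction on the number of forms, which
needs no topology. The dual variables are node potentials, tolls and a multiplier of the cost.
The program for one commodity is the aggregated program of a network with a single commodity, so
duality is proved only once.
-/

open scoped Matrix

noncomputable section

/-! ### The Farkas lemma -/

/-- **Farkas lemma** for linear forms: a form that is nonnegative wherever all the forms `φ i` are
is a nonnegative combination of them. In the induction step, if the form `φ a` cannot be dropped,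
the other forms are replaced by their compositions with a projection onto its kernel. -/
theorem exists_nonneg_combination_of_forall_nonneg {W ι : Type*} [AddCommGroup W] [Module ℝ W]
    (s : Finset ι) : ∀ (φ : ι → W →ₗ[ℝ] ℝ) (b : W →ₗ[ℝ] ℝ),
    (∀ y, (∀ i ∈ s, 0 ≤ φ i y) → 0 ≤ b y) →
    ∃ c : ι → ℝ, (∀ i, 0 ≤ c i) ∧ ∀ y, b y = ∑ i ∈ s, c i * φ i y := by
  classical
  induction s using Finset.induction_on with
  | empty =>
    intro φ b h
    refine ⟨0, fun _ => le_rfl, fun y => ?_⟩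
    have h1 := h y (by simp)
    have h2 := h (-y) (by simp)
    rw [map_neg] at h2
    simp only [Finset.sum_empty]
    linarith
  | insert a s ha ih =>
    intro φ b h
    by_cases hs : ∀ y, (∀ i ∈ s, 0 ≤ φ i y) → 0 ≤ b y
    · obtain ⟨c, hc, hb⟩ := ih φ b hs
      refine ⟨Function.update c a 0, fun i => ?_, fun y => ?_⟩
      · by_cases hi : i = a
        · simp [hi]
        · simpa [hi] using hc i
      · rw [Finset.sum_insert ha, hb y]
        simp only [Function.update_self, zero_mul, zero_add]
        refine Finset.sum_congr rfl fun i hi => ?_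
        rw [Function.update_of_ne (ne_of_mem_of_not_mem hi ha)]
    · push Not at hs
      obtain ⟨y₁, hy₁, hb₁⟩ := hs
      have hneg : φ a y₁ < 0 := by
        by_contra! hge
        exact absurd (h y₁ fun i hi => by
          rcases Finset.mem_insert.1 hi with rfl | hi
          · exact hge
          · exact hy₁ i hi) (not_le.2 hb₁)
      -- Rescaled so that `φ a y₀ = -1`; the map `y ↦ y + φ a y • y₀` then projects onto `ker (φ a)`.
      obtain ⟨y₀, hy₀, hb₀, ha₀⟩ :
          ∃ y₀, (∀ i ∈ s, 0 ≤ φ i y₀) ∧ b y₀ < 0 ∧ φ a y₀ = -1 := by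
        have hpos : 0 < (-φ a y₁)⁻¹ := inv_pos.2 (neg_pos.2 hneg)
        refine ⟨(-φ a y₁)⁻¹ • y₁, fun i hi => ?_, ?_, ?_⟩
        · rw [map_smul, smul_eq_mul]; exact mul_nonneg hpos.le (hy₁ i hi)
        · rw [map_smul, smul_eq_mul]; exact mul_neg_of_pos_of_neg hpos hb₁
        · rw [map_smul, smul_eq_mul]; field_simp [hneg.ne]
      obtain ⟨c, hc, hb⟩ := ih (fun i => φ i + φ i y₀ • φ a) (b + b y₀ • φ a) (by
        intro y hy
        have := h (y + φ a y • y₀) fun i hi => by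
          rcases Finset.mem_insert.1 hi with rfl | hi
          · simp [ha₀]
          · have := hy i hi
            simp only [LinearMap.add_apply, LinearMap.smul_apply, smul_eq_mul] at this
            rw [map_add, map_smul, smul_eq_mul]
            linarith
        rw [map_add, map_smul, smul_eq_mul] at this
        simp only [LinearMap.add_apply, LinearMap.smul_apply, smul_eq_mul]
        linarith)
      have hsum : 0 ≤ ∑ i ∈ s, c i * φ i y₀ :=
        Finset.sum_nonneg fun i hi => mul_nonneg (hc i) (hy₀ i hi)
      refine ⟨Function.update c a (∑ i ∈ s, c i * φ i y₀ - b y₀), fun i => ?_, fun y => ?_⟩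
      · by_cases hi : i = a
        · subst hi; simp only [Function.update_self]; linarith
        · simpa [hi] using hc i
      · have hy := hb y
        simp only [LinearMap.add_apply, LinearMap.smul_apply, smul_eq_mul, mul_add,
          Finset.sum_add_distrib] at hy
        rw [Finset.sum_insert ha, Function.update_self, sub_mul, Finset.sum_mul]
        have : ∑ i ∈ s, Function.update c a (∑ i ∈ s, c i * φ i y₀ - b y₀) i * φ i y
            = ∑ i ∈ s, c i * φ i y := Finset.sum_congr rfl fun i hi => by
          rw [Function.update_of_ne (ne_of_mem_of_not_mem hi ha)]
        rw [this]
        simp only [← mul_assoc] at hy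
        linarith

/-! ### Extreme points of Minkowski sums -/

/-- A point of the Minkowski sum `C` of convex sets `D k` is extreme if and only if all its
decompositions consist of extreme points. Moving one summand along a segment moves the sum along
a segment; conversely a segment in `C` splits into segments in the `D k`. -/
theorem sum_mem_extremePoints_iff {E κ : Type*} [AddCommGroup E] [Module ℝ E] [Fintype κ]
    {C : Set E} {D : κ → Set E} (hD : ∀ k, Convex ℝ (D k))
    (hC : ∀ p, p ∈ C ↔ ∃ q : κ → E, (∀ k, q k ∈ D k) ∧ ∑ k, q k = p) {p : E} (hp : p ∈ C) :
    p ∈ C.extremePoints ℝ ↔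
      ∀ q : κ → E, (∀ k, q k ∈ D k) → ∑ k, q k = p → ∀ k, q k ∈ (D k).extremePoints ℝ := by
  classical
  constructor
  · rintro hext q hq rfl k
    refine mem_extremePoints_iff_left.2 ⟨hq k, fun u hu v hv huv => ?_⟩
    have key : ∀ u ∈ D k, ∑ j, Function.update q k u j ∈ C := fun u hu =>
      (hC _).2 ⟨_, fun j => by
        by_cases hj : j = k
        · subst hj; simpa using hu
        · simpa [hj] using hq j, rfl⟩
    have hupd : ∀ u, ∑ j, Function.update q k u j = u + ∑ j ∈ Finset.univ \ {k}, q j := fun u =>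
      Finset.sum_update_of_mem (Finset.mem_univ k) q u
    have hself : ∑ j, q j = q k + ∑ j ∈ Finset.univ \ {k}, q j := by
      rw [← hupd, Function.update_eq_self]
    have := (mem_extremePoints_iff_left.1 hext).2 _ (key u hu) _ (key v hv) (by
      obtain ⟨a, b, ha, hb, hab, h⟩ := huv
      refine ⟨a, b, ha, hb, hab, ?_⟩
      rw [hupd, hupd, hself, ← h]
      simp only [smul_add]
      rw [add_add_add_comm, ← add_smul, hab, one_smul])
    rw [hupd, hself] at this
    exact add_right_cancel this
  · intro h
    refine mem_extremePoints_iff_left.2 ⟨hp, fun u hu v hv huv => ?_⟩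
    obtain ⟨qu, hqu, rfl⟩ := (hC _).1 hu
    obtain ⟨qv, hqv, rfl⟩ := (hC _).1 hv
    obtain ⟨a, b, ha, hb, hab, rfl⟩ := huv
    have hmem : ∀ k, a • qu k + b • qv k ∈ D k := fun k =>
      hD k (hqu k) (hqv k) ha.le hb.le hab
    have hsum : ∑ k, (a • qu k + b • qv k) = a • ∑ k, qu k + b • ∑ k, qv k := by
      rw [Finset.sum_add_distrib, Finset.smul_sum, Finset.smul_sum]
    rw [← hsum]
    exact Finset.sum_congr rfl fun k _ =>
      (mem_extremePoints_iff_left.1 (h _ hmem hsum k)).2 _ (hqu k) _ (hqv k)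
        ⟨a, b, ha, hb, hab, rfl⟩

/-! ### Strong bilevel feasibility and extreme points of the epigraph -/

section Epigraph

variable {ι : Type*}

/-- An extreme point of an epigraph lies on the graph: otherwise it is the midpoint of a vertical
segment. -/
theorem eq_of_mem_extremePoints_epigraphOf {h : (ι → ℝ) → EReal} {w : ι → ℝ} {z : ℝ}
    (hz : (w, z) ∈ (epigraphOf h).extremePoints ℝ) : h w = z := by
  refine le_antisymm hz.1 (le_of_not_gt fun hlt => ?_)
  obtain ⟨y, hy, hyz⟩ := EReal.lt_iff_exists_real_btwn.1 hlt
  have hyz' : y < z := EReal.coe_lt_coe_iff.1 hyz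
  have := (mem_extremePoints_iff_left.1 hz).2 (w, y) hy.le (w, 2 * z - y)
    (hz.1.trans (EReal.coe_le_coe_iff.2 (show z ≤ 2 * z - y by linarith)))
    ⟨1 / 2, 1 / 2, by norm_num, by norm_num, by norm_num, by
      ext
      · simp only [Prod.fst_add, Prod.smul_fst, Pi.add_apply, Pi.smul_apply, smul_eq_mul]; ring
      · simp only [Prod.snd_add, Prod.smul_snd, smul_eq_mul]; ring⟩
  exact hyz'.ne (congrArg Prod.snd this)

/-- Over a single point `w`, a non-vertical face of the epigraph is a single point. -/
theorem isStronglyBilevelFeasible_iff {h : (ι → ℝ) → EReal} {w : ι → ℝ} :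
    IsStronglyBilevelFeasible h w ↔ ∃ z : ℝ, (w, z) ∈ (epigraphOf h).extremePoints ℝ := by
  constructor
  · rintro ⟨F, ⟨-, -, hext⟩, hvert, hproj⟩
    have hfst : ∀ p ∈ F, p.1 = w := fun p hp => by
      have : p.1 ∈ ({w} : Set (ι → ℝ)) := hproj ▸ ⟨p.2, hp⟩
      exact this
    obtain ⟨z, hz⟩ : w ∈ {w | ∃ z : ℝ, (w, z) ∈ F} := hproj ▸ rfl
    refine ⟨z, ?_⟩
    have hF : F = {(w, z)} := by
      refine Set.eq_singleton_iff_unique_mem.2 ⟨hz, fun p hp => Prod.ext (hfst p hp) ?_⟩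
      by_contra hne
      have hdir := vsub_mem_vectorSpan ℝ hp hz
      rw [← direction_affineSpan] at hdir
      refine hvert ?_
      have hsmul := (affineSpan ℝ F).direction.smul_mem (p.2 - z)⁻¹ hdir
      have : (p.2 - z)⁻¹ • (p -ᵥ (w, z)) = ((0, 1) : (ι → ℝ) × ℝ) := by
        ext
        · simp [hfst p hp]
        · simp [inv_mul_cancel₀ (sub_ne_zero.2 hne)]
      rwa [this] at hsmul
    rwa [hF, isExtreme_singleton] at hext
  · rintro ⟨z, hz⟩
    refine ⟨{(w, z)}, ⟨Set.singleton_nonempty _, convex_singleton _, isExtreme_singleton.2 hz⟩,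
      ?_, ?_⟩
    · rw [direction_affineSpan, vectorSpan_singleton, Submodule.mem_bot]
      exact fun h => one_ne_zero (congrArg Prod.snd h)
    · ext v; simp

theorem conjugateOf_le_coe_iff [Fintype ι] {f : (ι → ℝ) → EReal} {w : ι → ℝ} {z : ℝ} :
    conjugateOf f w ≤ z ↔ ∀ t, f t ≤ ((z + t ⬝ᵥ w : ℝ) : EReal) := by
  rw [conjugateOf, iSup_le_iff]
  refine forall_congr' fun t => ?_
  rw [EReal.sub_le_iff_le_add (.inl (EReal.coe_ne_bot _)) (.inl (EReal.coe_ne_top _)),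
    EReal.coe_add]

end Epigraph

/-! ### Linear programming duality for the pricing problem -/

namespace PricingNetwork

variable {V A K : Type*}

theorem toTolled_nonneg (N : PricingNetwork V A K) {x : A → ℝ} (hx : 0 ≤ x) :
    0 ≤ N.toTolled x :=
  fun e => hx (e : A)

variable [Fintype A]

open Classical in
/-- The linear form `t ↦ t_a` giving the toll on the arc `a`, which is zero on toll-free arcs. -/
def tollForm (N : PricingNetwork V A K) (a : A) : (N.tolled → ℝ) →ₗ[ℝ] ℝ :=
  if h : a ∈ N.tolled then LinearMap.proj ⟨a, h⟩ else 0

theorem sum_mul_tollForm (N : PricingNetwork V A K) (x : A → ℝ) (t : N.tolled → ℝ) :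
    ∑ a, x a * N.tollForm a t = t ⬝ᵥ N.toTolled x := by
  classical
  have h : ∀ a (ha : a ∈ N.tolled), N.tollForm a t = t ⟨a, ha⟩ := fun a ha => by
    simp [tollForm, ha]
  rw [← Finset.sum_subset (Finset.subset_univ N.tolled) fun a _ ha => by simp [tollForm, ha],
    ← Finset.sum_coe_sort]
  exact Finset.sum_congr rfl fun e _ => by rw [h e e.2, mul_comm]; rfl

/-- Only tolled arcs can have negative cost, so their use bounds the cost of a flow from below. -/
theorem neg_abs_cost_dotProduct_le {N : PricingNetwork V A K} {x : A → ℝ} (hx : 0 ≤ x) :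
    -((fun e : N.tolled => |N.cost e|) ⬝ᵥ N.toTolled x) ≤ N.cost ⬝ᵥ x := by
  classical
  have h : (fun e : N.tolled => |N.cost e|) ⬝ᵥ N.toTolled x =
      ∑ a, if a ∈ N.tolled then |N.cost a| * x a else 0 := by
    rw [← Finset.sum_filter, Finset.filter_univ_mem, ← Finset.sum_coe_sort]
    rfl
  rw [h, ← Finset.sum_neg_distrib]
  refine Finset.sum_le_sum fun a _ => ?_
  split_ifs with ha
  · rw [← neg_mul]
    exact mul_le_mul_of_nonneg_right (neg_abs_le _) (hx a)
  · rw [neg_zero]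
    exact mul_nonneg (N.cost_nonneg a ha) (hx a)

variable [DecidableEq V]

/-- The flows `xᵏ` are feasible, use together at most `w` of the tolled arcs, and have total cost
at most `z`. -/
def IsFlowBelow [Fintype K] (N : PricingNetwork V A K) (w : N.tolled → ℝ) (z : ℝ)
    (x : K → A → ℝ) : Prop :=
  (∀ k, x k ∈ N.feasibleSet k) ∧ ∑ k, N.toTolled (x k) ≤ w ∧ ∑ k, N.cost ⬝ᵥ x k ≤ z

/-- The left-hand side of the dual constraint of the variable `xᵏ_a`, as a linear form in the
node potentials `π`, the tolls `t` and the multiplier `α` of the cost. -/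
def dualForm [Fintype V] (N : PricingNetwork V A K) (k : K) (a : A) :
    ((K → V → ℝ) × (N.tolled → ℝ) × ℝ) →ₗ[ℝ] ℝ where
  toFun y := (y.1 k ᵥ* N.incidence) a + N.tollForm a y.2.1 + y.2.2 * N.cost a
  map_add' y y' := by
    simp only [Prod.fst_add, Prod.snd_add, Pi.add_apply, Matrix.add_vecMul, map_add]; ring
  map_smul' r y := by
    simp only [Prod.smul_fst, Prod.smul_snd, Pi.smul_apply, Matrix.smul_vecMul, map_smul,
      smul_eq_mul, RingHom.id_apply]; ring

theorem sum_mul_dualForm [Fintype V] (N : PricingNetwork V A K) (k : K) (x : A → ℝ)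
    (y : (K → V → ℝ) × (N.tolled → ℝ) × ℝ) :
    ∑ a, x a * N.dualForm k a y =
      y.1 k ⬝ᵥ (N.incidence *ᵥ x) + y.2.1 ⬝ᵥ N.toTolled x + y.2.2 * (N.cost ⬝ᵥ x) := by
  simp only [dualForm, LinearMap.coe_mk, AddHom.coe_mk, mul_add, Finset.sum_add_distrib,
    sum_mul_tollForm]
  rw [Matrix.dotProduct_mulVec]
  congr 1
  · congr 1
    exact Finset.sum_congr rfl fun a _ => mul_comm _ _
  · rw [dotProduct, Finset.mul_sum]
    exact Finset.sum_congr rfl fun a _ => by ring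

/-- The dual objective `∑ₖ πᵏ bᵏ + tᵀ w + α z`. -/
def boundForm [Fintype V] [Fintype K] (N : PricingNetwork V A K) (w : N.tolled → ℝ) (z : ℝ) :
    ((K → V → ℝ) × (N.tolled → ℝ) × ℝ) →ₗ[ℝ] ℝ where
  toFun y := ∑ k, y.1 k ⬝ᵥ N.supply k + y.2.1 ⬝ᵥ w + y.2.2 * z
  map_add' y y' := by
    simp only [Prod.fst_add, Prod.snd_add, Pi.add_apply, add_dotProduct, Finset.sum_add_distrib]
    ring
  map_smul' r y := by
    simp only [Prod.smul_fst, Prod.smul_snd, Pi.smul_apply, smul_dotProduct, smul_eq_mul,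
      RingHom.id_apply, ← Finset.mul_sum]
    ring

/-- If `g w ≤ z`, the dual objective is nonnegative at all dual feasible points. -/
theorem boundForm_nonneg [Fintype V] [Fintype K] {N : PricingNetwork V A K} {w : N.tolled → ℝ}
    {z : ℝ} (h : N.aggregatedBaseCost w ≤ z) {y : (K → V → ℝ) × (N.tolled → ℝ) × ℝ}
    (hx : ∀ k a, 0 ≤ N.dualForm k a y) (ht : 0 ≤ y.2.1) (hα : 0 ≤ y.2.2) :
    0 ≤ N.boundForm w z y := by
  have pos : ∀ y : (K → V → ℝ) × (N.tolled → ℝ) × ℝ, (∀ k a, 0 ≤ N.dualForm k a y) →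
      0 ≤ y.2.1 → 0 < y.2.2 → 0 ≤ N.boundForm w z y := by
    rintro ⟨π, t, α⟩ hx ht hα
    dsimp only at ht hα
    have hle := conjugateOf_le_coe_iff.1 h (α⁻¹ • t)
    -- By weak duality the potentials `-α⁻¹ • π` bound the optimal value at the tolls `α⁻¹ • t`.
    have hge : ((-(α⁻¹ * ∑ k, π k ⬝ᵥ N.supply k) : ℝ) : EReal) ≤
        N.aggregatedCost (α⁻¹ • t) := by
      refine le_iInf fun x => le_iInf fun v => le_iInf fun ⟨hxf, _, hxv⟩ => ?_
      rw [EReal.coe_le_coe_iff, smul_dotProduct, smul_eq_mul]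
      have h1 : ∀ k, 0 ≤ π k ⬝ᵥ N.supply k + t ⬝ᵥ N.toTolled (x k) + α * (N.cost ⬝ᵥ x k) :=
        fun k => by
          have := N.sum_mul_dualForm k (x k) (π, t, α)
          rw [(hxf k).1] at this
          rw [← this]
          exact Finset.sum_nonneg fun a _ => mul_nonneg ((hxf k).2 a) (hx k a)
      have h2 := Finset.sum_nonneg fun k (_ : k ∈ Finset.univ) => h1 k
      rw [Finset.sum_add_distrib, Finset.sum_add_distrib, ← Finset.mul_sum, ← dotProduct_sum]
        at h2
      have h3 : t ⬝ᵥ ∑ k, N.toTolled (x k) ≤ t ⬝ᵥ v := dotProduct_le_dotProduct_of_nonneg_left hxv ht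
      have h4 := mul_nonneg (inv_nonneg.2 hα.le) (h2.trans (by
        gcongr : _ ≤ ∑ k, π k ⬝ᵥ N.supply k + t ⬝ᵥ v + α * ∑ k, N.cost ⬝ᵥ x k))
      rw [mul_add, mul_add, inv_mul_cancel_left₀ hα.ne'] at h4
      linarith
    have := EReal.coe_le_coe_iff.1 (hge.trans hle)
    rw [smul_dotProduct, smul_eq_mul] at this
    have h5 := mul_nonneg hα.le (sub_nonneg.2 this)
    have h6 : α * (z + α⁻¹ * t ⬝ᵥ w - -(α⁻¹ * ∑ k, π k ⬝ᵥ N.supply k)) =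
        ∑ k, π k ⬝ᵥ N.supply k + t ⬝ᵥ w + α * z := by
      field_simp
      ring
    rw [h6] at h5
    exact h5
  -- A dual feasible point with positive cost multiplier; adding a small multiple of it to `y`
  -- reduces to the case above.
  let y₀ : (K → V → ℝ) × (N.tolled → ℝ) × ℝ := (0, fun e => |N.cost e|, 1)
  have hy₀ : ∀ k a, 0 ≤ N.dualForm k a y₀ := fun k a => by
    simp only [dualForm, LinearMap.coe_mk, AddHom.coe_mk, y₀, Pi.zero_apply,
      Matrix.zero_vecMul, zero_add, one_mul, tollForm]
    split_ifs with ha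
    · simpa using (by linarith [neg_abs_le (N.cost a)] : 0 ≤ |N.cost a| + N.cost a)
    · simpa using N.cost_nonneg a ha
  have hε : ∀ ε : ℝ, 0 < ε → 0 ≤ N.boundForm w z y + ε * N.boundForm w z y₀ := fun ε hε => by
    have := pos (y + ε • y₀) (fun k a => by
      rw [map_add, map_smul, smul_eq_mul]
      exact add_nonneg (hx k a) (mul_nonneg hε.le (hy₀ k a)))
      (fun e => add_nonneg (ht e) (mul_nonneg hε.le (abs_nonneg _)))
      (add_pos_of_nonneg_of_pos hα (mul_pos hε one_pos))
    rwa [map_add, map_smul, smul_eq_mul] at this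
  refine ge_of_tendsto' (x := Filter.atTop)
    (f := fun n : ℕ => N.boundForm w z y + (1 / ((n : ℝ) + 1)) * N.boundForm w z y₀) ?_
    fun n => hε _ (by positivity)
  simpa using (tendsto_one_div_add_atTop_nhds_zero_nat.mul_const (N.boundForm w z y₀)).const_add
    (N.boundForm w z y)

/-- Strong duality with attainment: `g w ≤ z` if and only if some flows within the capacities `w`
cost at most `z`. -/
theorem aggregatedBaseCost_le_coe_iff [Fintype V] [Fintype K] {N : PricingNetwork V A K}
    {w : N.tolled → ℝ} {z : ℝ} :
    N.aggregatedBaseCost w ≤ z ↔ ∃ x, N.IsFlowBelow w z x := by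
  classical
  constructor
  · intro h
    let φ : (K × A) ⊕ N.tolled ⊕ Unit → ((K → V → ℝ) × (N.tolled → ℝ) × ℝ) →ₗ[ℝ] ℝ :=
      Sum.elim (fun i => N.dualForm i.1 i.2) (Sum.elim
        (fun e => LinearMap.proj e ∘ₗ LinearMap.fst ℝ _ _ ∘ₗ LinearMap.snd ℝ _ _)
        (fun _ => LinearMap.snd ℝ _ _ ∘ₗ LinearMap.snd ℝ _ _))
    obtain ⟨c, hc, hb⟩ := exists_nonneg_combination_of_forall_nonneg Finset.univ φ
      (N.boundForm w z) fun y hy => boundForm_nonneg h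
        (fun k a => hy (.inl (k, a)) (Finset.mem_univ _))
        (fun e => hy (.inr (.inl e)) (Finset.mem_univ _))
        (hy (.inr (.inr ())) (Finset.mem_univ _))
    let x : K → A → ℝ := fun k a => c (.inl (k, a))
    let s : N.tolled → ℝ := fun e => c (.inr (.inl e))
    have hb' : ∀ (π : K → V → ℝ) (t : N.tolled → ℝ) (α : ℝ),
        ∑ k, π k ⬝ᵥ N.supply k + t ⬝ᵥ w + α * z =
          ∑ k, π k ⬝ᵥ (N.incidence *ᵥ x k) + t ⬝ᵥ (∑ k, N.toTolled (x k) + s) +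
            α * (∑ k, N.cost ⬝ᵥ x k + c (.inr (.inr ()))) := fun π t α => by
      have := hb (π, t, α)
      have hx : ∀ k, ∑ a, c (.inl (k, a)) * N.dualForm k a (π, t, α) = _ := fun k =>
        N.sum_mul_dualForm k (x k) (π, t, α)
      simp only [Fintype.sum_sum_type, Fintype.sum_prod_type, φ, Sum.elim_inl, Sum.elim_inr,
        hx, Finset.univ_unique, Finset.sum_singleton, Finset.sum_add_distrib,
        ← Finset.mul_sum, ← dotProduct_sum] at this
      have hs : ∑ e, c (.inr (.inl e)) * t e = t ⬝ᵥ s :=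
        Finset.sum_congr rfl fun e _ => mul_comm _ _
      rw [dotProduct_add]
      change _ = _ + (∑ e, c (.inr (.inl e)) * t e + c (.inr (.inr ())) * α) at this
      rw [hs] at this
      change ∑ k, π k ⬝ᵥ N.supply k + t ⬝ᵥ w + α * z = _ at this
      rw [this, ← dotProduct_sum]
      ring
    -- The coefficients of `π`, `t` and `α` on the two sides of `hb'` agree; `s` and the last
    -- coefficient are the slacks.
    refine ⟨x, fun k => ⟨?_, fun a => hc _⟩, fun e => ?_, ?_⟩
    · ext v
      have := hb' (Pi.single k (Pi.single v 1)) 0 0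
      have hsum : ∀ u : K → V → ℝ,
          ∑ j, (Pi.single k (Pi.single v 1) : K → V → ℝ) j ⬝ᵥ u j = u k v := fun u => by
        rw [Finset.sum_eq_single k (fun j _ hj => by simp [Pi.single_eq_of_ne hj])
          (fun h => absurd (Finset.mem_univ _) h)]
        simp
      rw [hsum, hsum (fun j => N.incidence *ᵥ x j)] at this
      simpa using this.symm
    · have := hb' 0 (Pi.single e 1) 0
      simp only [Pi.zero_apply, zero_dotProduct, Finset.sum_const_zero, single_one_dotProduct,
        zero_mul, add_zero, zero_add, Pi.add_apply] at this
      rw [this]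
      exact le_add_of_nonneg_right (hc _)
    · have := hb' 0 0 1
      simp only [Pi.zero_apply, zero_dotProduct, Finset.sum_const_zero, one_mul, zero_add] at this
      rw [this]
      exact le_add_of_nonneg_right (hc _)
  · rintro ⟨x, hx, hxw, hxz⟩
    have hw : 0 ≤ w := (Finset.sum_nonneg fun k _ => N.toTolled_nonneg (hx k).2).trans hxw
    refine conjugateOf_le_coe_iff.2 fun t => ?_
    have : N.aggregatedCost t ≤ ((∑ k, N.cost ⬝ᵥ x k + t ⬝ᵥ w : ℝ) : EReal) :=
      iInf₂_le_of_le x w (iInf_le _ ⟨hx, hw, hxw⟩)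
    refine this.trans ?_
    rw [EReal.coe_le_coe_iff]
    linarith

/-- The network with `k` as its only commodity. -/
def single (N : PricingNetwork V A K) (k : K) : PricingNetwork V A Unit where
  src := N.src
  tgt := N.tgt
  tolled := N.tolled
  cost := N.cost
  origin _ := N.origin k
  dest _ := N.dest k
  cost_nonneg := N.cost_nonneg
  origin_ne_dest _ := N.origin_ne_dest k
  toll_free_path _ := N.toll_free_path k

theorem followerBaseCost_eq_single (N : PricingNetwork V A K) (k : K) :
    N.followerBaseCost k = (N.single k).aggregatedBaseCost := by
  have : N.followerCost k = (N.single k).aggregatedCost := by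
    funext t
    unfold followerCost aggregatedCost
    refine (Equiv.funUnique Unit (A → ℝ)).symm.iInf_congr fun x => iInf_congr fun w => ?_
    refine iInf_congr_Prop ?_ fun _ => ?_
    · refine and_congr ⟨fun h => h (), fun h _ => h⟩ (and_congr Iff.rfl ?_)
      rw [Fintype.sum_unique]
      rfl
    · rw [Fintype.sum_unique]
      rfl
  rw [followerBaseCost, aggregatedBaseCost, this]
  rfl

theorem followerBaseCost_le_coe_iff [Fintype V] {N : PricingNetwork V A K} {k : K}
    {w : N.tolled → ℝ} {z : ℝ} :
    N.followerBaseCost k w ≤ z ↔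
      ∃ x ∈ N.feasibleSet k, N.toTolled x ≤ w ∧ N.cost ⬝ᵥ x ≤ z := by
  rw [followerBaseCost_eq_single]
  refine (aggregatedBaseCost_le_coe_iff (N := N.single k)).trans ?_
  refine (Equiv.funUnique Unit (A → ℝ)).exists_congr_left.trans (exists_congr fun x => ?_)
  refine and_congr ⟨fun h => h (), fun h _ => h⟩ ?_
  rw [Fintype.sum_unique, Fintype.sum_unique]
  rfl

/-! ### Finiteness of the base costs -/

theorem exists_tollFree_flow (N : PricingNetwork V A K) (k : K) :
    ∃ x ∈ N.feasibleSet k, N.toTolled x = 0 := by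
  classical
  have key : ∀ v, Relation.ReflTransGen
      (fun u v => ∃ a, a ∉ N.tolled ∧ N.src a = u ∧ N.tgt a = v) (N.origin k) v →
      ∃ x : A → ℝ, 0 ≤ x ∧ N.toTolled x = 0 ∧
        N.incidence *ᵥ x = Pi.single (N.origin k) 1 - Pi.single v 1 := by
    intro v hv
    induction hv with
    | refl => exact ⟨0, le_rfl, rfl, by simp⟩
    | tail _ h ih =>
      obtain ⟨a, ha, rfl, rfl⟩ := h
      obtain ⟨x, hx, hx0, hxb⟩ := ih
      refine ⟨x + Pi.single a 1, add_nonneg hx (Pi.single_nonneg.2 zero_le_one), ?_, ?_⟩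
      · funext e
        have he : (e : A) ≠ a := fun h => ha (h ▸ e.2)
        have := congrFun hx0 e
        simp only [toTolled, Pi.zero_apply] at this
        simp [toTolled, this, Pi.single_eq_of_ne he]
      · rw [Matrix.mulVec_add, hxb, Matrix.mulVec_single_one]
        funext i
        simp only [incidence, Pi.add_apply, Pi.sub_apply, Matrix.col_apply, Matrix.of_apply,
          Pi.single_apply, eq_comm (a := i)]
        ring
  obtain ⟨x, hx, hx0, hxb⟩ := key _ (N.toll_free_path k)
  refine ⟨x, ⟨?_, hx⟩, hx0⟩
  rw [hxb]
  funext v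
  have := N.origin_ne_dest k
  simp only [supply, Pi.sub_apply, Pi.single_apply]
  split_ifs with h1 h2 h2
  · exact absurd (h1.symm.trans h2) this
  all_goals simp

theorem aggregatedBaseCost_ne_top [Fintype V] [Fintype K] (N : PricingNetwork V A K)
    {w : N.tolled → ℝ} (hw : 0 ≤ w) : N.aggregatedBaseCost w ≠ ⊤ := by
  choose x hx hx0 using N.exists_tollFree_flow
  exact ne_top_of_le_ne_top (EReal.coe_ne_top _)
    (aggregatedBaseCost_le_coe_iff.2 ⟨x, hx, by simpa [hx0] using hw, le_rfl⟩)

theorem followerBaseCost_ne_bot [Fintype V] (N : PricingNetwork V A K) (k : K)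
    (w : N.tolled → ℝ) : N.followerBaseCost k w ≠ ⊥ := by
  intro h
  obtain ⟨x, hx, hxw, hxz⟩ := followerBaseCost_le_coe_iff.1
    (h.trans_le (bot_le (a := ((-((fun e : N.tolled => |N.cost e|) ⬝ᵥ w) - 1 : ℝ) : EReal))))
  have h1 := neg_abs_cost_dotProduct_le (N := N) hx.2
  have h2 : (fun e : N.tolled => |N.cost e|) ⬝ᵥ N.toTolled x ≤
      (fun e : N.tolled => |N.cost e|) ⬝ᵥ w :=
    dotProduct_le_dotProduct_of_nonneg_left hxw fun e => abs_nonneg _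
  linarith

theorem aggregatedBaseCost_ne_bot [Fintype V] [Fintype K] (N : PricingNetwork V A K)
    (w : N.tolled → ℝ) : N.aggregatedBaseCost w ≠ ⊥ := by
  intro h
  obtain ⟨x, hx, hxw, hxz⟩ := aggregatedBaseCost_le_coe_iff.1
    (h.trans_le (bot_le (a := ((-((fun e : N.tolled => |N.cost e|) ⬝ᵥ w) - 1 : ℝ) : EReal))))
  have h1 := Finset.sum_le_sum fun k (_ : k ∈ Finset.univ) =>
    neg_abs_cost_dotProduct_le (N := N) (hx k).2
  rw [Finset.sum_neg_distrib, ← dotProduct_sum] at h1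
  have h2 : (fun e : N.tolled => |N.cost e|) ⬝ᵥ ∑ k, N.toTolled (x k) ≤
      (fun e : N.tolled => |N.cost e|) ⬝ᵥ w :=
    dotProduct_le_dotProduct_of_nonneg_left hxw fun e => abs_nonneg _
  linarith

/-! ### The epigraph of the aggregated base cost as a Minkowski sum -/

theorem convex_epigraphOf_followerBaseCost [Fintype V] (N : PricingNetwork V A K) (k : K) :
    Convex ℝ (epigraphOf (N.followerBaseCost k)) := by
  rintro ⟨u, y⟩ hu ⟨v, z⟩ hv a b ha hb hab
  obtain ⟨x, hx, hxu, hxy⟩ := followerBaseCost_le_coe_iff.1 hu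
  obtain ⟨x', hx', hxv, hxz⟩ := followerBaseCost_le_coe_iff.1 hv
  refine followerBaseCost_le_coe_iff.2 ⟨a • x + b • x', ⟨?_, ?_⟩, ?_, ?_⟩
  · rw [Matrix.mulVec_add, Matrix.mulVec_smul, Matrix.mulVec_smul, hx.1, hx'.1, ← add_smul, hab,
      one_smul]
  · exact add_nonneg (smul_nonneg ha hx.2) (smul_nonneg hb hx'.2)
  · exact add_le_add (smul_le_smul_of_nonneg_left hxu ha) (smul_le_smul_of_nonneg_left hxv hb)
  · rw [dotProduct_add, dotProduct_smul, dotProduct_smul]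
    exact add_le_add (smul_le_smul_of_nonneg_left hxy ha) (smul_le_smul_of_nonneg_left hxz hb)

/-- The epigraph of `g` is the Minkowski sum of the epigraphs of the `gᵏ`. -/
theorem mem_epigraphOf_aggregatedBaseCost_iff [Fintype V] [Fintype K] [Nonempty K]
    (N : PricingNetwork V A K) (p : (N.tolled → ℝ) × ℝ) :
    p ∈ epigraphOf N.aggregatedBaseCost ↔
      ∃ q : K → (N.tolled → ℝ) × ℝ, (∀ k, q k ∈ epigraphOf (N.followerBaseCost k)) ∧
        ∑ k, q k = p := by
  classical
  constructor
  · intro hp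
    obtain ⟨x, hx, hxw, hxz⟩ := aggregatedBaseCost_le_coe_iff.1 hp
    obtain ⟨k₀⟩ := ‹Nonempty K›
    let r : (N.tolled → ℝ) × ℝ := p - ∑ k, (N.toTolled (x k), N.cost ⬝ᵥ x k)
    have hr : 0 ≤ r := sub_nonneg.2 ⟨by simpa [Prod.fst_sum] using hxw,
      by simpa [Prod.snd_sum] using hxz⟩
    -- All the slack is handed to the single commodity `k₀`.
    refine ⟨fun k => (N.toTolled (x k), N.cost ⬝ᵥ x k) + Pi.single (M := fun _ => _) k₀ r k,
      fun k => ?_, ?_⟩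
    · have hk : 0 ≤ (Pi.single k₀ r : K → (N.tolled → ℝ) × ℝ) k := by
        rcases eq_or_ne k k₀ with rfl | hne
        · rwa [Pi.single_eq_same]
        · rw [Pi.single_eq_of_ne hne]
      exact followerBaseCost_le_coe_iff.2
        ⟨x k, hx k, le_add_of_nonneg_right hk.1, le_add_of_nonneg_right hk.2⟩
    · rw [Finset.sum_add_distrib, Finset.sum_pi_single', if_pos (Finset.mem_univ _)]
      exact add_sub_cancel _ _
  · rintro ⟨q, hq, rfl⟩
    choose x hx hxw hxz using fun k => followerBaseCost_le_coe_iff.1 (hq k)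
    refine aggregatedBaseCost_le_coe_iff.2 ⟨x, hx, ?_, ?_⟩
    · rw [Prod.fst_sum]; exact Finset.sum_le_sum fun k _ => hxw k
    · rw [Prod.snd_sum]; exact Finset.sum_le_sum fun k _ => hxz k

end PricingNetwork

/-! ### Finite sums of extended reals -/

theorem EReal.coe_finsetSum {κ : Type*} (s : Finset κ) (f : κ → ℝ) :
    ((∑ k ∈ s, f k : ℝ) : EReal) = ∑ k ∈ s, (f k : EReal) := by
  classical
  induction s using Finset.induction_on with
  | empty => simp
  | insert a s ha ih => rw [Finset.sum_insert ha, Finset.sum_insert ha, EReal.coe_add, ih]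

theorem EReal.ne_top_of_sum_ne_top {κ : Type*} {s : Finset κ} {f : κ → EReal}
    (hbot : ∀ k ∈ s, f k ≠ ⊥) (hs : ∑ k ∈ s, f k ≠ ⊤) {k : κ} (hk : k ∈ s) : f k ≠ ⊤ := by
  classical
  rw [← Finset.add_sum_erase s f hk] at hs
  refine ((EReal.add_ne_top_iff_ne_top₂ (hbot k hk) ?_).1 hs).1
  exact Finset.sum_induction f (· ≠ ⊥)
    (fun _ _ ha hb h => (EReal.add_eq_bot_iff.1 h).elim ha hb) EReal.zero_ne_bot
    fun j hj => hbot j (Finset.mem_of_mem_erase hj)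

end

/-! ### Decompositions and strong bilevel feasibility -/

theorem mainTheorem6 {V A K : Type*} [Fintype V] [DecidableEq V] [Fintype A] [Fintype K]
    [Nonempty K] (N : PricingNetwork V A K) (w : N.tolled → ℝ) (hw : 0 ≤ w) :
    IsStronglyBilevelFeasible N.aggregatedBaseCost w ↔
      ∀ ws : K → N.tolled → ℝ, N.IsBilevelFeasibleDecomposition w ws →
        ∀ k, IsStronglyBilevelFeasible (N.followerBaseCost k) (ws k) := by
  obtain ⟨z, hz⟩ : ∃ z : ℝ, N.aggregatedBaseCost w = z :=
    ⟨_, (EReal.coe_toReal (N.aggregatedBaseCost_ne_top hw)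
      (N.aggregatedBaseCost_ne_bot w)).symm⟩
  have hsum := N.mem_epigraphOf_aggregatedBaseCost_iff
  have hext := sum_mem_extremePoints_iff N.convex_epigraphOf_followerBaseCost hsum
    (p := (w, z)) hz.le
  constructor
  · rw [isStronglyBilevelFeasible_iff]
    rintro ⟨z', hz'⟩ ws ⟨rfl, hws⟩ k
    obtain rfl : z = z' :=
      EReal.coe_eq_coe_iff.1 (hz.symm.trans (eq_of_mem_extremePoints_epigraphOf hz'))
    have htop : ∀ j, N.followerBaseCost j (ws j) ≠ ⊤ := fun j =>
      EReal.ne_top_of_sum_ne_top (fun i _ => N.followerBaseCost_ne_bot i _)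
        (hws ▸ N.aggregatedBaseCost_ne_top hw) (Finset.mem_univ j)
    let y : K → ℝ := fun j => (N.followerBaseCost j (ws j)).toReal
    have hy : ∀ j, N.followerBaseCost j (ws j) = y j := fun j =>
      (EReal.coe_toReal (htop j) (N.followerBaseCost_ne_bot j _)).symm
    have hyz : ∑ j, y j = z := by
      rw [← EReal.coe_eq_coe_iff, EReal.coe_finsetSum, ← hz, hws]
      exact Finset.sum_congr rfl fun j _ => (hy j).symm
    exact isStronglyBilevelFeasible_iff.2 ⟨y k, hext.1 hz' (fun j => (ws j, y j))
      (fun j => (hy j).le) (Prod.ext (by simp [Prod.fst_sum]) (by simpa [Prod.snd_sum] using hyz)) k⟩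
  · intro h
    refine isStronglyBilevelFeasible_iff.2 ⟨z, hext.2 fun q hq hqz => ?_⟩
    -- The minimality of `z` forces every summand onto the graph of its base cost.
    have hle : ∀ j, N.followerBaseCost j (q j).1 ≤ ((q j).2 : EReal) := hq
    let y : K → ℝ := fun j => (N.followerBaseCost j (q j).1).toReal
    have hy : ∀ j, N.followerBaseCost j (q j).1 = y j := fun j =>
      (EReal.coe_toReal (ne_top_of_le_ne_top (EReal.coe_ne_top _) (hle j))
        (N.followerBaseCost_ne_bot j _)).symm
    have hyq : ∀ j, y j ≤ (q j).2 := fun j => by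
      have := hle j
      rwa [hy, EReal.coe_le_coe_iff] at this
    have hw' : ∑ j, (q j).1 = w := by rw [← Prod.fst_sum, hqz]
    have hz' : ∑ j, (q j).2 = z := by rw [← Prod.snd_sum, hqz]
    have hmem : (w, ∑ j, y j) ∈ epigraphOf N.aggregatedBaseCost :=
      (hsum _).2 ⟨fun j => ((q j).1, y j), fun j => (hy j).le,
        Prod.ext (by simpa [Prod.fst_sum] using hw') (by simp [Prod.snd_sum])⟩
    have hzy : z ≤ ∑ j, y j := EReal.coe_le_coe_iff.1 (hz.symm.trans_le hmem)
    have hyq' : ∀ j, y j = (q j).2 := fun j =>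
      (Finset.sum_eq_sum_iff_of_le fun j _ => hyq j).1
        (le_antisymm (Finset.sum_le_sum fun j _ => hyq j) (hz'.trans_le hzy)) j (Finset.mem_univ j)
    intro k
    obtain ⟨z', hk⟩ := isStronglyBilevelFeasible_iff.1 (h (fun j => (q j).1) ⟨hw'.symm, by
      change N.aggregatedBaseCost (∑ j, (q j).1) = ∑ j, N.followerBaseCost j (q j).1
      rw [hw', hz, ← hz', EReal.coe_finsetSum]
      exact Finset.sum_congr rfl fun j _ => by rw [hy, hyq']⟩ k)
    have : z' = (q k).2 := by
      rw [← hyq', ← EReal.coe_eq_coe_iff, ← hy, ← eq_of_mem_extremePoints_epigraphOf hk]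
    rwa [this] at hk
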